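/- **Theorem.** Let $X$ be an arbitrary topological space (no separation axioms are assumed). Let $\mathcal O$ be the collection of all open covers of $X$ (sets of open subsets of $X$ whose union is $X$), let $\Omega$ be the collection of all $\mathscr U\in\mathcal O$ such that every finite subset of $X$ is contained in a member of $\mathscr U$, and let $\mathcal K$ be the collection of all $\mathscr U\in\mathcal O$ such that every compact subset of $X$ is contained in a member of $\mathscr U$ (in all three cases $X$ itself may be a member of the cover). For collections $\mathcal A,\mathcal B$, the game $\mathsf G_{\mathrm{fin}}(\mathcal A,\mathcal B)$ is played by P1 and P2 as follows: in each round $n\in\omega$, P1 plays $A_n\in\mathcal A$ and P2 answers with a finite set $\mathscr F_n\subseteq A_n$; P2 wins if $\bigcup_{n\in\omega}\mathscr F_n\in\mathcal B$, and P1 wins otherwise. A strategy of P1 determines each $A_n$ from $\mathscr F_0,\dots,\mathscr F_{n-1}$; it is predetermined if $A_n$ depends only on $n$, and constant if $A_n$ is the same for all $n$. A strategy of P2 determines each (legal) $\mathscr F_n$ from $A_0,\dots,A_n$; it is Markov if $\mathscr F_n$ depends only on $A_n$ and $n$. For such games $\mathcal G,\mathcal H$, write $\mathcal G\le^+_{\mathrm{II}}\mathcal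 H$ if all of the following hold: 1. if P2 has a winning Markov strategy in $\mathcal G$, then P2 has one in $\mathcal H$; 2. if P2 has a winning strategy in $\mathcal G$, then P2 has one in $\mathcal H$; 3. if P1 has no winning strategy in $\mathcal G$, then P1 has none in $\mathcal H$; 4. if P1 has no winning predetermined strategy in $\mathcal G$, then P1 has none in $\mathcal H$; 5. if P1 has no constant winning strategy in $\mathcal G$, then P1 has none in $\mathcal H$. Then $$\mathsf G_{\mathrm{fin}}(\mathcal K,\mathcal K)\ \le^+_{\mathrm{II}}\ \mathsf G_{\mathrm{fin}}(\Omega,\Omega)\ \le^+_{\mathrm{II}}\ \mathsf G_{\mathrm{fin}}(\mathcal O,\mathcal O).$$ Moreover, let $\mathsf S_{\mathrm{fin}}(\mathcal A,\mathcal B)$ denote the statement that for all $A_0,A_1,\dots\in\mathcal A$ there are finite $\mathscr F_n\subseteq A_n$ with $\bigcup_{n}\mathscr F_n\in\mathcal B$. Then $\mathsf S_{\mathrm{fin}}(\mathcal K,\mathcal K)\Rightarrow\mathsf S_{\mathrm{fin}}(\Omega,\Omega)\Rightarrow\mathsf S_{\mathrm{fin}}(\mathcal O,\mathcal O)$. Likewise,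 if every $\mathscr U\in\mathcal K$ has a countable subset belonging to $\mathcal K$, then every $\mathscr U\in\Omega$ has a countable subset belonging to $\Omega$; and if the latter holds, then every $\mathscr U\in\mathcal O$ has a countable subset belonging to $\mathcal O$. -/

import Mathlib

universe u v

/-- An open cover of `X`, as a set of subsets of `X`. -/
def IsOpenSetCover (X : Type u) [TopologicalSpace X] (C : Set (Set X)) : Prop :=
  (∀ U ∈ C, IsOpen U) ∧ ⋃₀ C = Set.univ

/-- `𝒪_X`: the open covers of `X`. -/
def OpenCovers (X : Type u) [TopologicalSpace X] : Set (Set (Set X)) :=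
  {C | IsOpenSetCover X C}

/-- `Ω_X`: the open covers such that every finite subset of `X` is contained in a member. -/
def OmegaCovers (X : Type u) [TopologicalSpace X] : Set (Set (Set X)) :=
  {C | IsOpenSetCover X C ∧ ∀ F : Set X, F.Finite → ∃ U ∈ C, F ⊆ U}

/-- `𝒦_X`: the open covers such that every compact subset of `X` is contained in a member. -/
def KCovers (X : Type u) [TopologicalSpace X] : Set (Set (Set X)) :=
  {C | IsOpenSetCover X C ∧ ∀ K : Set X, IsCompact K → ∃ U ∈ C, K ⊆ U}

/-- The finite-selection game `G_fin(𝒜, ℬ)`, given by its two collections. In round `n`, P1 plays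
`A n ∈ 𝒜` and P2 answers with a finite `F n ⊆ A n`; P2 wins when `⋃ n, F n ∈ ℬ`. -/
structure FinSelectionGame (α : Type u) where
  /-- the moves of P1 -/
  moves : Set (Set α)
  /-- the unions with which P2 wins -/
  target : Set (Set α)

/-- The notation `G_fin(𝒜, ℬ)`. -/
def Gfin {α : Type u} (A B : Set (Set α)) : FinSelectionGame α := ⟨A, B⟩

namespace FinSelectionGame

variable {α : Type u} (G : FinSelectionGame α)

/-- The choices `F n` of P2 obey the rules when P1 plays `A n`. -/
def Legal (A : ℕ → G.moves) (F : ℕ → Finset α) : Prop :=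
  ∀ n, (F n : Set α) ⊆ (A n : Set α)

/-- P2 wins a run with choices `F n`. -/
def WonByII (F : ℕ → Finset α) : Prop :=
  (⋃ n, (F n : Set α)) ∈ G.target

/-- The finite sequence `⟨x 0, …, x (n - 1)⟩`. -/
def initSeg {β : Type v} (x : ℕ → β) (n : ℕ) : List β := (List.range n).map x

/-- P1 has a winning strategy: a move of P1 depends on all earlier choices of P2. -/
def IWins : Prop :=
  ∃ σ : List (Finset α) → G.moves, ∀ F : ℕ → Finset α,
    G.Legal (fun n => σ (initSeg F n)) F → ¬ G.WonByII F

/-- P1 has a winning predetermined strategy: a move of P1 depends on the turn number only. -/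
def IWinsPre : Prop :=
  ∃ σ : ℕ → G.moves, ∀ F : ℕ → Finset α, G.Legal σ F → ¬ G.WonByII F

/-- P1 has a constant winning strategy. -/
def IWinsCnst : Prop :=
  ∃ A₀ : G.moves, ∀ F : ℕ → Finset α, G.Legal (fun _ => A₀) F → ¬ G.WonByII F

/-- P2 has a winning strategy: the choice in round `n` depends on `A 0, …, A n`. -/
def IIWins : Prop :=
  ∃ σ : List G.moves → Finset α, ∀ A : ℕ → G.moves,
    G.Legal A (fun n => σ (initSeg A (n + 1))) ∧ G.WonByII (fun n => σ (initSeg A (n + 1)))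

/-- P2 has a winning Markov strategy: the choice in round `n` depends on `A n` and `n` only. -/
def IIWinsMark : Prop :=
  ∃ σ : G.moves → ℕ → Finset α, ∀ A : ℕ → G.moves,
    G.Legal A (fun n => σ (A n) n) ∧ G.WonByII (fun n => σ (A n) n)

/-- `G ≤_II H`: winning plays for P2 transfer from `G` to `H`. -/
structure LeII {α : Type u} {β : Type v} (G : FinSelectionGame α) (H : FinSelectionGame β) :
    Prop where
  mark : G.IIWinsMark → H.IIWinsMark
  strat : G.IIWins → H.IIWins
  notI : ¬ G.IWins → ¬ H.IWins
  notPre : ¬ G.IWinsPre → ¬ H.IWinsPre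

/-- `G ≤⁺_II H`: as `G ≤_II H`, also at the level of constant strategies of P1. -/
structure LeIIPlus {α : Type u} {β : Type v} (G : FinSelectionGame α) (H : FinSelectionGame β) :
    Prop extends LeII G H where
  notCnst : ¬ G.IWinsCnst → ¬ H.IWinsCnst

end FinSelectionGame

/-- The selection principle `S_fin(𝒜, ℬ)`. -/
def Sfin {α : Type u} (A B : Set (Set α)) : Prop :=
  ∀ a : ℕ → Set α, (∀ n, a n ∈ A) →
    ∃ F : ℕ → Finset α, (∀ n, (F n : Set α) ⊆ a n) ∧ (⋃ n, (F n : Set α)) ∈ B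

/-- Every member of `𝒜` has a countable subset that belongs to `𝒜`. For `𝒪_X`, `Ω_X`, `𝒦_X` this
says that `X` is Lindelöf, `ω`-Lindelöf, `k`-Lindelöf. -/
def LindelofFor {α : Type u} (A : Set (Set α)) : Prop :=
  ∀ a ∈ A, ∃ b ⊆ a, b.Countable ∧ b ∈ A

/-! For an ω-cover `C` and compact `K`, the boxes `Uⁿ` with `U ∈ C` cover `Kⁿ`; compactness and the
tube lemma give an open `V ⊇ K` with `Vⁿ` inside finitely many boxes. Hence `captured n C` is a
k-cover. P2 answers the ω-game by translating round `n` through `captured n` and replacing each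
chosen `V` by finitely many members of `C`. A finite `S` is then captured once it lies in a `V`
chosen in some round `n ≥ |S|`. Such a late round exists if `X` is never chosen, and `X` can be
removed from these covers when `X` is not compact; when it is compact, P2 simply has a winning
Markov strategy. From Ω to 𝒪, covers are translated to their finite unions. Constant strategies
amount to the Lindelöf properties, which are compared directly because the first translation varies
with the round. -/

/-- A tube lemma for finite powers: a neighbourhood of `Kⁿ` contains `Vⁿ` for some open `V ⊇ K`. -/
theorem IsCompact.exists_isOpen_pow_subset {X : Type u} [TopologicalSpace X] {K : Set X}
    (hK : IsCompact K) : ∀ (n : ℕ) {O : Set (Fin n → X)}, IsOpen O →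
      (Set.univ.pi fun _ => K) ⊆ O →
      ∃ V, IsOpen V ∧ K ⊆ V ∧ (Set.univ.pi fun _ : Fin n => V) ⊆ O
  | 0, O, _, h => ⟨Set.univ, isOpen_univ, Set.subset_univ _, fun x _ => h fun i => i.elim0⟩
  | n + 1, O, hO, h => by
    have hc : Continuous fun p : X × (Fin n → X) => (Fin.cons p.1 p.2 : Fin (n + 1) → X) :=
      Continuous.finCons (A := fun _ => X) continuous_fst continuous_snd
    obtain ⟨u, v, hu, hv, hKu, hKv, huv⟩ := generalized_tube_lemma hK
      (isCompact_univ_pi fun _ : Fin n => hK) (hO.preimage hc) (by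
        rintro ⟨a, f⟩ ⟨ha, hf⟩
        refine h fun i _ => ?_
        refine Fin.cases ha (fun j => ?_) i
        simpa using hf j trivial)
    obtain ⟨V, hV, hKV, hVv⟩ := hK.exists_isOpen_pow_subset n hv hKv
    refine ⟨u ∩ V, hu.inter hV, Set.subset_inter hKu hKV, fun x hx => ?_⟩
    have hmem : (x 0, Fin.tail x) ∈ u ×ˢ v :=
      ⟨(hx 0 trivial).1, hVv fun i _ => (hx i.succ trivial).2⟩
    have := huv hmem
    simpa using this

/-- Repeating a point pads the enumeration, so the single power `n` handles all smaller nonempty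
sets. -/
theorem Finset.exists_fin_subset_range {β : Type u} {S : Finset β} (hS : S.Nonempty) {n : ℕ}
    (hn : S.card ≤ n) : ∃ x : Fin n → β, Set.range x = S := by
  obtain ⟨b, hb⟩ := hS
  refine ⟨fun i => if h : (i : ℕ) < S.card then S.equivFin.symm ⟨i, h⟩ else b, ?_⟩
  ext c
  constructor
  · rintro ⟨i, rfl⟩
    dsimp only
    split_ifs with h
    · exact (S.equivFin.symm ⟨i, h⟩).2
    · exact hb
  · intro hc
    refine ⟨⟨S.equivFin ⟨c, hc⟩, (S.equivFin ⟨c, hc⟩).2.trans_le hn⟩, ?_⟩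
    simp

/-- Discarding finitely many proper subsets of `X` from a cover by which finite sets are
captured leaves such a cover. -/
theorem exists_superset_ge {X : Type u} {F : ℕ → Finset (Set X)} (hF : ∀ n, ∀ V ∈ F n, V ≠ Set.univ)
    (h : ∀ S : Set X, S.Finite → ∃ V ∈ ⋃ n, (F n : Set (Set X)), S ⊆ V) (m : ℕ) {S : Set X}
    (hS : S.Finite) : ∃ n ≥ m, ∃ V ∈ F n, S ⊆ V := by
  classical
  have hpt : ∀ V : Set X, V ≠ Set.univ → ∃ x, x ∉ V := fun V hV =>
    (Set.ne_univ_iff_exists_notMem V).1 hV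
  let E : Set (Set X) := ⋃ n ∈ Set.Iio m, (F n : Set (Set X))
  have hE : E.Finite := (Set.finite_Iio m).biUnion fun n _ => (F n).finite_toSet
  have hEne : ∀ V : E, ∃ x, x ∉ (V : Set X) := by
    rintro ⟨V, hV⟩
    obtain ⟨n, -, hn⟩ := Set.mem_iUnion₂.1 hV
    exact hpt V (hF n V hn)
  choose p hp using hEne
  have : Finite E := hE
  -- Each early set misses one of the added points, so the capturing set comes from a late round.
  obtain ⟨V, hV, hSV⟩ := h (S ∪ Set.range p) (hS.union (Set.finite_range p))
  obtain ⟨n, hn⟩ := Set.mem_iUnion.1 hV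
  refine ⟨n, ?_, V, hn, Set.subset_union_left.trans hSV⟩
  by_contra! hlt
  exact hp ⟨V, Set.mem_biUnion hlt hn⟩ (hSV (Or.inr ⟨_, rfl⟩))

/-! ### Translating covers -/

section Covers

variable {X : Type u} [TopologicalSpace X]

/-- Every subset of `V` with at most `n` points lies in a member of `F`. -/
def CapturesSubsets (n : ℕ) (F : Finset (Set X)) (V : Set X) : Prop :=
  ∀ S : Finset X, S.card ≤ n → (S : Set X) ⊆ V → ∃ W ∈ F, (S : Set X) ⊆ W

/-- The open sets whose subsets with at most `n` points are captured by finitely many members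
of `C`. -/
def captured (n : ℕ) (C : Set (Set X)) : Set (Set X) :=
  {V | IsOpen V ∧ ∃ F : Finset (Set X), (F : Set (Set X)) ⊆ C ∧ CapturesSubsets n F V}

theorem captured_mono {n : ℕ} {C : Set (Set X)} {V W : Set X} (hV : V ∈ captured n C)
    (hW : IsOpen W) (hWV : W ⊆ V) : W ∈ captured n C := by
  obtain ⟨-, F, hFC, hF⟩ := hV
  exact ⟨hW, F, hFC, fun S hS hSW => hF S hS (hSW.trans hWV)⟩

theorem mem_omegaCovers_of_forall {C : Set (Set X)} (ho : ∀ U ∈ C, IsOpen U)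
    (h : ∀ S : Finset X, ∃ U ∈ C, (S : Set X) ⊆ U) : C ∈ OmegaCovers X := by
  refine ⟨⟨ho, Set.eq_univ_of_forall fun x => ?_⟩, fun F hF => ?_⟩
  · obtain ⟨U, hU, hx⟩ := h {x}
    exact ⟨U, hU, hx (by simp)⟩
  · simpa using h hF.toFinset

theorem mem_kCovers_of_forall {C : Set (Set X)} (ho : ∀ U ∈ C, IsOpen U)
    (h : ∀ K : Set X, IsCompact K → ∃ U ∈ C, K ⊆ U) : C ∈ KCovers X := by
  refine ⟨⟨ho, Set.eq_univ_of_forall fun x => ?_⟩, h⟩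
  obtain ⟨U, hU, hx⟩ := h {x} isCompact_singleton
  exact ⟨U, hU, hx rfl⟩

theorem exists_captured_superset {C : Set (Set X)} (hC : C ∈ OmegaCovers X) (n : ℕ) {K : Set X}
    (hK : IsCompact K) : ∃ V ∈ captured n C, K ⊆ V := by
  classical
  -- `W₀` captures the empty set, as the finite subcover may itself be empty.
  obtain ⟨W₀, hW₀, -⟩ := hC.2 ∅ Set.finite_empty
  obtain ⟨b, hbC, hb, hKb⟩ := (isCompact_univ_pi fun _ : Fin n => hK).elim_finite_subcover_image
    (b := C) (c := fun U => Set.univ.pi fun _ => U)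
    (fun U hU => isOpen_set_pi Set.finite_univ fun _ _ => hC.1.1 U hU) (by
      intro x _
      obtain ⟨U, hU, hx⟩ := hC.2 (Set.range x) (Set.finite_range x)
      exact Set.mem_biUnion hU fun i _ => hx ⟨i, rfl⟩)
  obtain ⟨V, hV, hKV, hVb⟩ := hK.exists_isOpen_pow_subset n
    (isOpen_biUnion fun U hU => isOpen_set_pi Set.finite_univ fun _ _ => hC.1.1 U (hbC hU)) hKb
  refine ⟨V, ⟨hV, insert W₀ hb.toFinset, ?_, fun S hS hSV => ?_⟩, hKV⟩
  · simpa [Set.insert_subset_iff] using ⟨hW₀, hbC⟩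
  · rcases S.eq_empty_or_nonempty with rfl | hne
    · exact ⟨W₀, by simp, by simp⟩
    · obtain ⟨x, hx⟩ := Finset.exists_fin_subset_range hne hS
      have hxV : x ∈ Set.univ.pi fun _ : Fin n => V := fun i _ => hSV (hx ▸ ⟨i, rfl⟩)
      obtain ⟨U, hU, hxU⟩ := Set.mem_iUnion₂.1 (hVb hxV)
      refine ⟨U, by simp [hU], hx ▸ ?_⟩
      rintro _ ⟨i, rfl⟩
      exact hxU i trivial

theorem captured_mem_kCovers {C : Set (Set X)} (hC : C ∈ OmegaCovers X) (n : ℕ) :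
    captured n C ∈ KCovers X :=
  mem_kCovers_of_forall (fun _ hU => hU.1) fun _ hK => exists_captured_superset hC n hK

/-- If `X` is not compact, then no compact set has `X` as its only open superset. -/
theorem exists_isOpen_ne_univ (hX : ¬ CompactSpace X) {K : Set X} (hK : IsCompact K) :
    ∃ W, IsOpen W ∧ K ⊆ W ∧ W ≠ Set.univ := by
  by_contra! h
  refine hX ⟨isCompact_of_finite_subcover fun U hU hcov => ?_⟩
  obtain ⟨t, ht⟩ := hK.elim_finite_subcover U hU ((Set.subset_univ K).trans hcov)
  exact ⟨t, (h _ (isOpen_biUnion fun i _ => hU i) ht).ge⟩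

theorem captured_diff_univ_mem_kCovers (hX : ¬ CompactSpace X) {C : Set (Set X)}
    (hC : C ∈ OmegaCovers X) (n : ℕ) : captured n C \ {Set.univ} ∈ KCovers X := by
  refine mem_kCovers_of_forall (fun _ hU => hU.1.1) fun K hK => ?_
  obtain ⟨V, hV, hKV⟩ := exists_captured_superset hC n hK
  obtain ⟨W, hW, hKW, hne⟩ := exists_isOpen_ne_univ hX hK
  refine ⟨V ∩ W, ⟨captured_mono hV (hV.1.inter hW) Set.inter_subset_left, fun h => hne ?_⟩,
    Set.subset_inter hKV hKW⟩
  exact Set.eq_univ_of_univ_subset (h.symm.subset.trans Set.inter_subset_right)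

/-- The unions of finitely many members of `C`. -/
def finiteUnions (C : Set (Set X)) : Set (Set X) :=
  {V | ∃ F : Finset (Set X), (F : Set (Set X)) ⊆ C ∧ V = ⋃₀ (F : Set (Set X))}

theorem finiteUnions_mem_omegaCovers {C : Set (Set X)} (hC : C ∈ OpenCovers X) :
    finiteUnions C ∈ OmegaCovers X := by
  classical
  refine mem_omegaCovers_of_forall ?_ fun S => ?_
  · rintro _ ⟨F, hF, rfl⟩
    exact isOpen_sUnion fun U hU => hC.1 U (hF hU)
  · have : ∀ x : X, ∃ U ∈ C, x ∈ U := fun x => hC.2.symm.subset (Set.mem_univ x)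
    choose U hU hx using this
    refine ⟨_, ⟨S.image U, ?_, rfl⟩, fun x hxS => ⟨U x, ?_, hx x⟩⟩
    · intro V hV
      obtain ⟨x, -, rfl⟩ := Finset.mem_image.1 (Finset.mem_coe.1 hV)
      exact hU x
    · exact Finset.mem_coe.2 (Finset.mem_image_of_mem U hxS)

end Covers

/-! ### Strategies and their transfer -/

namespace FinSelectionGame

theorem initSeg_succ {β : Type v} (x : ℕ → β) (n : ℕ) :
    initSeg x (n + 1) = initSeg x n ++ [x n] := by
  simp [initSeg, List.range_succ]

@[simp] theorem length_initSeg {β : Type v} (x : ℕ → β) (n : ℕ) : (initSeg x n).length = n := by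
  simp [initSeg]

/-- The first `n` terms of the sequence in which each term is given by `s` in terms of its index
and the preceding ones. -/
def playout {β : Type v} (s : ℕ → List β → β) : ℕ → List β
  | 0 => []
  | n + 1 => playout s n ++ [s n (playout s n)]

theorem initSeg_playout {β : Type v} (s : ℕ → List β → β) (n : ℕ) :
    initSeg (fun k => s k (playout s k)) n = playout s n := by
  induction n with
  | zero => rfl
  | succ n ih => rw [initSeg_succ, ih, playout]

theorem playout_congr {β : Type v} {s t : ℕ → List β → β} {n : ℕ} (h : ∀ k < n, s k = t k) :
    playout s n = playout t n := by
  induction n with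
  | zero => rfl
  | succ n ih =>
    rw [playout, playout, ih fun k hk => h k (hk.trans n.lt_succ_self), h n n.lt_succ_self]

section

variable {α : Type u} {G : FinSelectionGame α}

theorem IIWins.of_iiWinsMark (h : G.IIWinsMark) : G.IIWins := by
  obtain ⟨σ, hσ⟩ := h
  refine ⟨fun L => (L.getLast?).elim ∅ fun a => σ a (L.length - 1), fun A => ?_⟩
  simpa [initSeg_succ] using hσ A

theorem IWins.of_iWinsPre (h : G.IWinsPre) : G.IWins := by
  obtain ⟨σ, hσ⟩ := h
  exact ⟨fun L => σ L.length, fun F hF => hσ F (by simpa using hF)⟩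

/-- Playing the two strategies against each other gives a run that both would win. -/
theorem not_iWins_of_iiWinsMark (h : G.IIWinsMark) : ¬ G.IWins := by
  rintro ⟨σ, hσ⟩
  obtain ⟨μ, hμ⟩ := h
  let s : ℕ → List (Finset α) → Finset α := fun n L => μ (σ L) n
  refine hσ (fun n => s n (playout s n)) ?_ ?_
  · simp only [initSeg_playout]
    exact (hμ fun n => σ (playout s n)).1
  · exact (hμ fun n => σ (playout s n)).2

end

section Translation

variable {α : Type u} {β : Type v} {G : FinSelectionGame α} {H : FinSelectionGame β}

/-- Moves of P1 are translated from `H` to `G` round by round, and answers of P2 back from `G`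
to `H` element by element. -/
theorem LeII.of_translation (T : ℕ → H.moves → G.moves) (u : ℕ → H.moves → α → Finset β)
    (hu : ∀ n a, ∀ x ∈ (T n a : Set α), (u n a x : Set β) ⊆ a)
    (hwin : ∀ (A : ℕ → H.moves) (F : ℕ → Finset α), G.Legal (fun n => T n (A n)) F →
      G.WonByII F → (⋃ n, ⋃ x ∈ F n, (u n (A n) x : Set β)) ∈ H.target) :
    LeII G H := by
  classical
  let b : ℕ → H.moves → Finset α → Finset β := fun n a F => F.biUnion (u n a)
  have hb : ∀ (A : ℕ → H.moves) (F : ℕ → Finset α), G.Legal (fun n => T n (A n)) F →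
      H.Legal A (fun n => b n (A n) (F n)) := by
    intro A F hF n y hy
    obtain ⟨x, hx, hy⟩ := Finset.mem_biUnion.1 (Finset.mem_coe.1 hy)
    exact hu n _ x (hF n hx) hy
  have hw : ∀ (A : ℕ → H.moves) (F : ℕ → Finset α), G.Legal (fun n => T n (A n)) F →
      G.WonByII F → H.WonByII (fun n => b n (A n) (F n)) := by
    intro A F hF hG
    have := hwin A F hF hG
    simpa [WonByII, b] using this
  constructor
  · rintro ⟨σ, hσ⟩
    refine ⟨fun a n => b n a (σ (T n a) n), fun A => ?_⟩
    have := hσ fun n => T n (A n)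
    exact ⟨hb A _ this.1, hw A _ this.1 this.2⟩
  · rintro ⟨σ, hσ⟩
    refine ⟨fun L => (L.getLast?).elim ∅ fun a => b (L.length - 1) a (σ (L.mapIdx T)),
      fun A => ?_⟩
    have key : ∀ n, (initSeg A n).mapIdx T = initSeg (fun k => T k (A k)) n := by
      intro n
      induction n with
      | zero => rfl
      | succ n ih => simp [initSeg_succ, List.mapIdx_append, ih]
    have h := hσ fun n => T n (A n)
    have e : ∀ n, ((initSeg A (n + 1)).getLast?).elim ∅ (fun a => b ((initSeg A (n + 1)).length - 1)
        a (σ ((initSeg A (n + 1)).mapIdx T))) =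
        b n (A n) (σ (initSeg (fun k => T k (A k)) (n + 1))) := by
      intro n
      rw [key, length_initSeg, initSeg_succ A]
      simp
    simp only [e]
    exact ⟨hb A _ h.1, hw A _ h.1 h.2⟩
  · rw [not_imp_not]
    rintro ⟨σ, hσ⟩
    -- P1's strategy in `H` sees only translated answers, so the position in `H` is rebuilt from the
    -- answers `g` given in `G`. Only entries below `L.length` are read, so the default `∅` is
    -- harmless.
    let s : (ℕ → Finset α) → ℕ → List (Finset β) → Finset β := fun g n L => b n (σ L) (g n)
    refine ⟨fun L => T L.length (σ (playout (s fun n => L.getD n ∅) L.length)), fun F hF hG => ?_⟩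
    have e : ∀ n, playout (s fun k => (initSeg F n).getD k ∅) n = playout (s F) n := by
      refine fun n => playout_congr fun k hk => ?_
      simp [s, initSeg, List.getD, hk]
    simp only [length_initSeg, e] at hF
    refine hσ (fun n => s F n (playout (s F) n)) ?_ ?_
    · simp only [initSeg_playout]
      exact hb (fun n => σ (playout (s F) n)) F hF
    · exact hw (fun n => σ (playout (s F) n)) F hF hG
  · rw [not_imp_not]
    rintro ⟨σ, hσ⟩
    exact ⟨fun n => T n (σ n), fun F hF hG => hσ _ (hb σ F hF) (hw σ F hF hG)⟩

theorem LeII.of_iiWinsMark (h : H.IIWinsMark) : LeII G H :=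
  ⟨fun _ => h, fun _ => .of_iiWinsMark h, fun _ => not_iWins_of_iiWinsMark h,
    fun _ hI => not_iWins_of_iiWinsMark h (.of_iWinsPre hI)⟩

end Translation

theorem not_iWinsPre_iff_sfin {α : Type u} {A B : Set (Set α)} :
    ¬ (Gfin A B).IWinsPre ↔ Sfin A B := by
  constructor
  · intro h a ha
    by_contra hF
    exact h ⟨fun n => ⟨a n, ha n⟩, fun F hleg hwon => hF ⟨F, hleg, hwon⟩⟩
  · rintro h ⟨σ, hσ⟩
    obtain ⟨F, hleg, hwon⟩ := h (fun n => σ n) fun n => (σ n).2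
    exact hσ F hleg hwon

/-- Finite selections have a countable union; conversely, a countable subcover can be chosen one
member per round. -/
theorem not_iWinsCnst_iff_lindelofFor {α : Type u} {A : Set (Set α)} :
    ¬ (Gfin A A).IWinsCnst ↔ LindelofFor A := by
  constructor
  · intro h a ha
    by_contra hb
    refine h ⟨⟨a, ha⟩, fun F hleg hwon => hb ⟨_, Set.iUnion_subset hleg, ?_, hwon⟩⟩
    exact Set.countable_iUnion fun n => (F n).countable_toSet
  · rintro h ⟨⟨a, ha⟩, hσ⟩
    obtain ⟨b, hba, hb, hbA⟩ := h a ha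
    rcases b.eq_empty_or_nonempty with rfl | hne
    · exact hσ (fun _ => ∅) (fun _ => by simp) (by simpa [WonByII, Gfin] using hbA)
    · obtain ⟨f, rfl⟩ := hb.exists_eq_range hne
      refine hσ (fun n => {f n}) (fun n => ?_) ?_
      · simpa using hba ⟨n, rfl⟩
      · simpa [WonByII, Gfin, Set.iUnion_singleton_eq_range] using hbA

end FinSelectionGame

open FinSelectionGame

/-! ### Comparing the three kinds of cover -/

section Comparison

variable (X : Type u) [TopologicalSpace X]

theorem iiWinsMark_omegaCovers [CompactSpace X] :
    (Gfin (OmegaCovers X) (OmegaCovers X)).IIWinsMark := by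
  have h : ∀ (a : (Gfin (OmegaCovers X) (OmegaCovers X)).moves) (n : ℕ),
      ∃ F : Finset (Set X), (F : Set (Set X)) ⊆ a ∧ CapturesSubsets n F (Set.univ : Set X) := by
    intro a n
    obtain ⟨V, ⟨-, F, hFa, hF⟩, hV⟩ := exists_captured_superset a.2 n isCompact_univ
    exact ⟨F, hFa, Set.eq_univ_of_univ_subset hV ▸ hF⟩
  choose σ hσ hcap using h
  refine ⟨σ, fun A => ⟨fun n => hσ (A n) n, mem_omegaCovers_of_forall ?_ fun S => ?_⟩⟩
  · intro U hU
    obtain ⟨n, hn⟩ := Set.mem_iUnion.1 hU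
    exact (A n).2.1.1 U (hσ _ _ hn)
  -- Round `|S|` alone already captures `S`.
  · obtain ⟨W, hW, hSW⟩ := hcap (A S.card) S.card S le_rfl (Set.subset_univ _)
    exact ⟨W, Set.mem_iUnion.2 ⟨_, hW⟩, hSW⟩

theorem leII_kCovers_omegaCovers : (Gfin (KCovers X) (KCovers X)).LeII
    (Gfin (OmegaCovers X) (OmegaCovers X)) := by
  by_cases hX : CompactSpace X
  · exact .of_iiWinsMark (iiWinsMark_omegaCovers X)
  have h : ∀ (n : ℕ) (a : (Gfin (OmegaCovers X) (OmegaCovers X)).moves) (V : Set X),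
      ∃ F : Finset (Set X), V ∈ captured n a.1 \ {Set.univ} →
        (F : Set (Set X)) ⊆ a ∧ CapturesSubsets n F V := by
    intro n a V
    by_cases hV : V ∈ captured n a.1 \ {Set.univ}
    · obtain ⟨⟨-, F, hF⟩, -⟩ := hV
      exact ⟨F, fun _ => hF⟩
    · exact ⟨∅, fun h => (hV h).elim⟩
  choose u hu using h
  refine .of_translation
    (fun n a => ⟨captured n a.1 \ {Set.univ}, captured_diff_univ_mem_kCovers hX a.2 n⟩) u
    (fun n a V hV => (hu n a V hV).1) fun A F hF hwon => mem_omegaCovers_of_forall ?_ fun S => ?_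
  · intro U hU
    obtain ⟨n, hU⟩ := Set.mem_iUnion.1 hU
    obtain ⟨V, hV, hU⟩ := Set.mem_iUnion₂.1 hU
    exact (A n).2.1.1 U ((hu n _ V (hF n hV)).1 hU)
  · obtain ⟨n, hn, V, hV, hSV⟩ := exists_superset_ge (fun n V hV => (hF n hV).2)
      (fun S hS => hwon.2 S hS.isCompact) S.card S.finite_toSet
    obtain ⟨W, hW, hSW⟩ := (hu n (A n) V (hF n hV)).2 S hn hSV
    exact ⟨W, Set.mem_iUnion.2 ⟨n, Set.mem_biUnion (Finset.mem_coe.2 hV) hW⟩, hSW⟩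

/-- All the covers `captured n a` are used at once, and countably many countable selections remain
countable. Since `S` can use `n = |S|`, no late round is needed and `X` need not be removed. -/
theorem lindelofFor_omegaCovers_of_kCovers (h : LindelofFor (KCovers X)) :
    LindelofFor (OmegaCovers X) := by
  intro a ha
  choose b hba hb hbK using fun n => h _ (captured_mem_kCovers ha n)
  choose F hFa hF using fun n (V : b n) => (hba n V.2).2
  have := fun n => (hb n).to_subtype
  have hsub : (⋃ n, ⋃ V, (F n V : Set (Set X))) ⊆ a :=
    Set.iUnion_subset fun n => Set.iUnion_subset fun V => hFa n V
  refine ⟨_, hsub, Set.countable_iUnion fun n => Set.countable_iUnion fun V =>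
    (F n V).countable_toSet, mem_omegaCovers_of_forall (fun U hU => ha.1.1 U (hsub hU)) fun S => ?_⟩
  obtain ⟨V, hV, hSV⟩ := (hbK S.card).2 S S.finite_toSet.isCompact
  obtain ⟨W, hW, hSW⟩ := hF S.card ⟨V, hV⟩ S le_rfl hSV
  exact ⟨W, Set.mem_iUnion₂.2 ⟨_, _, hW⟩, hSW⟩

theorem leII_omegaCovers_openCovers : (Gfin (OmegaCovers X) (OmegaCovers X)).LeII
    (Gfin (OpenCovers X) (OpenCovers X)) := by
  have h : ∀ (a : (Gfin (OpenCovers X) (OpenCovers X)).moves) (V : Set X),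
      ∃ F : Finset (Set X), V ∈ finiteUnions a.1 →
        (F : Set (Set X)) ⊆ a ∧ V = ⋃₀ (F : Set (Set X)) := by
    intro a V
    by_cases hV : V ∈ finiteUnions a.1
    · obtain ⟨F, hF⟩ := hV
      exact ⟨F, fun _ => hF⟩
    · exact ⟨∅, fun h => (hV h).elim⟩
  choose u hu using h
  refine .of_translation (fun _ a => ⟨finiteUnions a.1, finiteUnions_mem_omegaCovers a.2⟩)
    (fun _ => u) (fun _ a V hV => (hu a V hV).1) fun A F hF hwon =>
      ⟨?_, Set.eq_univ_of_forall fun x => ?_⟩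
  · intro U hU
    obtain ⟨n, hU⟩ := Set.mem_iUnion.1 hU
    obtain ⟨V, hV, hU⟩ := Set.mem_iUnion₂.1 hU
    exact (A n).2.1 U ((hu _ V (hF n hV)).1 hU)
  · obtain ⟨V, hV, hxV⟩ := hwon.1.2.symm.subset (Set.mem_univ x)
    obtain ⟨n, hn⟩ := Set.mem_iUnion.1 hV
    rw [(hu (A n) V (hF n hn)).2] at hxV
    obtain ⟨W, hW, hxW⟩ := hxV
    exact ⟨W, Set.mem_iUnion.2 ⟨n, Set.mem_biUnion hn hW⟩, hxW⟩

theorem lindelofFor_openCovers_of_omegaCovers (h : LindelofFor (OmegaCovers X)) :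
    LindelofFor (OpenCovers X) := by
  intro a ha
  obtain ⟨b, hba, hb, hbΩ⟩ := h _ (finiteUnions_mem_omegaCovers ha)
  choose F hFa hF using fun V : b => hba V.2
  have := hb.to_subtype
  have hsub : (⋃ V, (F V : Set (Set X))) ⊆ a := Set.iUnion_subset hFa
  refine ⟨_, hsub, Set.countable_iUnion fun V => (F V).countable_toSet,
    fun U hU => ha.1 U (hsub hU), Set.eq_univ_of_forall fun x => ?_⟩
  obtain ⟨V, hV, hxV⟩ := hbΩ.1.2.symm.subset (Set.mem_univ x)
  rw [show V = _ from hF ⟨V, hV⟩] at hxV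
  obtain ⟨W, hW, hxW⟩ := hxV
  exact ⟨W, Set.mem_iUnion.2 ⟨_, hW⟩, hxW⟩

end Comparison

theorem mainTheorem1 (X : Type*) [TopologicalSpace X] :
    ((Gfin (KCovers X) (KCovers X)).LeIIPlus (Gfin (OmegaCovers X) (OmegaCovers X)) ∧
      (Gfin (OmegaCovers X) (OmegaCovers X)).LeIIPlus (Gfin (OpenCovers X) (OpenCovers X))) ∧
    ((Sfin (KCovers X) (KCovers X) → Sfin (OmegaCovers X) (OmegaCovers X)) ∧
      (Sfin (OmegaCovers X) (OmegaCovers X) → Sfin (OpenCovers X) (OpenCovers X))) ∧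
    ((LindelofFor (KCovers X) → LindelofFor (OmegaCovers X)) ∧
      (LindelofFor (OmegaCovers X) → LindelofFor (OpenCovers X))) := by
  have hKΩ := leII_kCovers_omegaCovers X
  have hΩO := leII_omegaCovers_openCovers X
  have lKΩ := lindelofFor_omegaCovers_of_kCovers X
  have lΩO := lindelofFor_openCovers_of_omegaCovers X
  refine ⟨⟨⟨hKΩ, ?_⟩, ⟨hΩO, ?_⟩⟩, ⟨?_, ?_⟩, lKΩ, lΩO⟩
  · simpa only [not_iWinsCnst_iff_lindelofFor] using lKΩ
  · simpa only [not_iWinsCnst_iff_lindelofFor] using lΩO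
  · simpa only [not_iWinsPre_iff_sfin] using hKΩ.notPre
  · simpa only [not_iWinsPre_iff_sfin] using hΩO.notPre
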